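/- For $x\in\mathbb N$ let $\ell(x)$ be its binary length ($\ell(0)=0$), let $\mathrm{BIT}(i,x)=\lfloor x/2^i\rfloor \bmod 2$, and let $x\#y=2^{\ell(x)\ell(y)}$. **Circuits.** A circuit with $n$ inputs is a finite directed acyclic graph whose nodes (gates) are labelled by an input $x_i$ or a negated input $\neg x_i$ ($0\le i<n$; these have no predecessors), by $\neg$ (one predecessor), or by $\wedge$, $\vee$ or $\mathrm{Mod}\,2$ (unbounded fan-in; a $\mathrm{Mod}\,2$ gate returns the sum of its inputs modulo 2), with a list of pairwise distinct output gates $o_0,\dots,o_{m-1}$. A family $\mathcal C=(C_n)_{n\ge0}$, where $C_n$ has $n$ inputs, computes $f:\mathbb N\to\mathbb N$ if for all $x$, with $n=\ell(x)$, $f(x)=\sum_{j<m}2^j\,v_j$, where $v_j$ is the value of $o_j$ in $C_n$ on the inputs $x_i=\mathrm{BIT}(i,x)$. It has polynomial size if for some $k$ every $C_n$ has at most $n^k+k$ gates, and constant depth if the lengths of the directed paths in all $C_n$ are bounded by a constant. **Normal form.** $\mathcal C$ is in normal form of depth $d$ if there are no $\neg$ gates and every gate of $C_n$ has a level in $\{0,\dots,d\}$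 such that inputs and negated inputs are at level $0$, $\vee$ gates at levels $3e+1$, $\wedge$ gates at levels $3e+2$, $\mathrm{Mod}\,2$ gates at levels $3e+3$ ($e\ge 0$), and edges only go from a level to the next one. Moreover every gate carries a number, bounded by $n^k+k$ for some fixed $k$, such that: different gates of the same level have different numbers; $x_i$ has number $i$ and $\neg x_i$ has number $n+i$; the gates of level $d$ are exactly the output gates, and $o_j$ has number $j$; numbers may be reused on different levels, but whenever a gate $a$ of one level and a gate $b$ of the next level have the same pair of numbers as some edge of $C_n$, then $(a,b)$ is itself an edge. For such a family (with its levels and numbers), $\mathbf{circ}_{\mathcal C}=\{C,L_0^{in},L_0^{\neg}\}\cup\{L_e:1\le e\le d\}$ consists of the following characteristic functions: $C(x,\alpha,\beta)=1$ iff in $C_{\ell(x)}$ some gate with number $\alpha$ is a predecessor of some gate with number $\beta$; $L_0^{in}(x,t)=1$ (resp. $L_0^{\neg}(x,t)=1$) iff $t$ is the number of an input gate (resp. negated input gate) of $C_{\ell(x)}$; $L_e(x,t)=1$ iff $t$ is the number of a gate of level $e$ of $C_{\ell(x)}$. **Algebra.** $[\mathscr B_0,\mathbf{circ}_{\mathcal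 C};\circ,\ell\text{-ODE}_1,\ell\text{-2ODE}]$ is the smallest class of functions $\mathbb N^p\to\mathbb Z$ ($p\ge0$) that contains the basic functions $\mathscr B_0$, namely $0$, $1$, $\mathrm{sg}$ (on $\mathbb Z$: $\mathrm{sg}(z)=1$ if $z>0$, and $0$ otherwise), $\ell$, $+$ and $-$ (on $\mathbb Z$), $z\div2=\lfloor z/2\rfloor$ (on $\mathbb Z$), $\#$, $\mathrm{BIT}$ and the projections, contains the functions in $\mathbf{circ}_{\mathcal C}$, and is closed under composition (an argument that ranges over $\mathbb N$ may only be substituted by a function with values in $\mathbb N$) and the following two schemas. Let $g:\mathbb N^p\to\mathbb N$ and $k:\mathbb N^{p+1}\to\{0,1\}$ be in the class, and write $\frac{\partial f(x,\mathbf y)}{\partial\ell}=h$ for $f(x+1,\mathbf y)=f(x,\mathbf y)+(\ell(x+1)-\ell(x))\cdot h$. * $\ell$-ODE$_1$: the solution $f$ of $f(0,\mathbf y)=g(\mathbf y)$, $\frac{\partial f(x,\mathbf y)}{\partial\ell}=f(x,\mathbf y)+k(x,\mathbf y)$ is in the class. * $\ell$-2ODE: if $g$ takes values in $\{0,1\}$,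 the solution $f$ of $f(0,\mathbf y)=g(\mathbf y)$, $\frac{\partial f(x,\mathbf y)}{\partial\ell}=-2\,k(x,\mathbf y)\,f(x,\mathbf y)+k(x,\mathbf y)$ is in the class. **Proposition.** Let $f:\mathbb N\to\mathbb N$. 1. If $f$ is computed by a polynomial-size family $\mathcal C$ in normal form of some depth $d$ (independent of $n$), then $f\in[\mathscr B_0,\mathbf{circ}_{\mathcal C};\circ,\ell\text{-ODE}_1,\ell\text{-2ODE}]$. 2. If $f$ is computed by any polynomial-size, constant-depth family of circuits as above, then $f$ is also computed by a polynomial-size family in normal form of some constant depth, so that part 1 applies to $f$. -/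

import Mathlib

/-! ## Boolean circuits with unbounded fan-in and parity gates -/

/-- Labels of the nodes of a circuit with `n` inputs: an input, a negated input (a literal, so a
node without predecessors), or an internal gate. `and`, `or`, `mod2` gates have unbounded fan-in. -/
inductive GateKind (n : ℕ) : Type
  | input (i : Fin n)
  | negInput (i : Fin n)
  | not
  | and
  | or
  | mod2

/-- A Boolean circuit with `n` inputs: a finite vertex-labelled directed acyclic graph
(for a finite graph, acyclicity is well-foundedness of the edge relation) with distinguished,
pairwise distinct output nodes `out 0, …, out (numOut - 1)`. `edge a b` says that `a` is a
predecessor of `b`. -/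
structure Circuit (n : ℕ) where
  Gate : Type
  fintypeGate : Fintype Gate
  kind : Gate → GateKind n
  edge : Gate → Gate → Prop
  acyclic : WellFounded edge
  no_edge_input : ∀ a b, edge a b → ∀ i, kind b ≠ GateKind.input i
  no_edge_negInput : ∀ a b, edge a b → ∀ i, kind b ≠ GateKind.negInput i
  fanin_not : ∀ b, kind b = GateKind.not → ∃! a, edge a b
  numOut : ℕ
  out : Fin numOut ↪ Gate

attribute [instance] Circuit.fintypeGate

namespace Circuit

/-- The number of gates. -/
def size {n : ℕ} (c : Circuit n) : ℕ := Fintype.card c.Gate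

open Classical in
/-- The value of a gate in terms of the values `w` of its predecessors, on input bits `x`. A `not`
gate has exactly one predecessor; a `mod2` gate returns the sum of its inputs modulo 2. -/
noncomputable def gateOp {n : ℕ} (c : Circuit n) (x : Fin n → Bool) (b : c.Gate)
    (w : (a : c.Gate) → c.edge a b → Bool) : Bool :=
  match c.kind b with
  | GateKind.input i => x i
  | GateKind.negInput i => !(x i)
  | GateKind.not => decide (∀ a, ∀ h : c.edge a b, w a h = false)
  | GateKind.and => decide (∀ a, ∀ h : c.edge a b, w a h = true)
  | GateKind.or => decide (∃ a, ∃ h : c.edge a b, w a h = true)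
  | GateKind.mod2 => decide ((∑ a : {a : c.Gate // c.edge a b}, (w a.1 a.2).toNat) % 2 = 1)

/-- The value of each gate on input bits `x`, by recursion along the edges. -/
noncomputable def val {n : ℕ} (c : Circuit n) (x : Fin n → Bool) : c.Gate → Bool :=
  c.acyclic.fix (fun b w => c.gateOp x b w)

theorem val_eq {n : ℕ} (c : Circuit n) (x : Fin n → Bool) (b : c.Gate) :
    c.val x b = c.gateOp x b (fun a _ => c.val x a) :=
  WellFounded.fix_eq _ _ _

/-- The number whose binary digits are the outputs (output `j` is the digit of weight `2 ^ j`). -/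
noncomputable def outputNumber {n : ℕ} (c : Circuit n) (x : Fin n → Bool) : ℕ :=
  ∑ j : Fin c.numOut, (c.val x (c.out j)).toNat * 2 ^ (j : ℕ)

/-- All directed paths have length (number of edges) at most `d`. -/
def DepthLE {n : ℕ} (c : Circuit n) (d : ℕ) : Prop :=
  ∀ l : List c.Gate, l.IsChain c.edge → l.length ≤ d + 1

end Circuit

/-- `f : ℕ → ℕ` is computed by the family `C`: on input `x`, of binary length `n = Nat.size x`,
the value `f x` is output by `C n` when input `i` is the bit of `x` of weight `2 ^ i`. -/
def Computes (C : (n : ℕ) → Circuit n) (f : ℕ → ℕ) : Prop :=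
  ∀ x : ℕ, f x = (C (Nat.size x)).outputNumber (fun i => x.testBit i)

/-- Polynomial size. -/
def PolySize (C : (n : ℕ) → Circuit n) : Prop :=
  ∃ k : ℕ, ∀ n, (C n).size ≤ n ^ k + k

/-- Constant depth. -/
def ConstDepth (C : (n : ℕ) → Circuit n) : Prop :=
  ∃ d : ℕ, ∀ n, (C n).DepthLE d

/-! ## Normal form and the functions describing a circuit family -/

/-- `c` is in normal form with levels `0, …, d`: the literals are at level `0`, `or` gates at levels
`3e + 1`, `and` gates at levels `3e + 2`, `mod2` gates at levels `3e + 3`, and edges only join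
consecutive levels. Gates of the same level carry different numbers: input `i` has number `i`, its
negation has number `n + i`; the gates of level `d` are exactly the outputs, and output `j` has
number `j`. Numbers may be reused on different levels, provided that the pairs of numbers of
adjacent gates still describe the graph (`edge_of_num`). -/
structure NormalForm {n : ℕ} (c : Circuit n) (d : ℕ) where
  level : c.Gate → ℕ
  num : c.Gate → ℕ
  level_le : ∀ g, level g ≤ d
  level_input : ∀ g i, c.kind g = GateKind.input i → level g = 0
  level_negInput : ∀ g i, c.kind g = GateKind.negInput i → level g = 0
  no_not : ∀ g, c.kind g ≠ GateKind.not
  level_or : ∀ g, c.kind g = GateKind.or → level g % 3 = 1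
  level_and : ∀ g, c.kind g = GateKind.and → level g % 3 = 2
  level_mod2 : ∀ g, c.kind g = GateKind.mod2 → level g % 3 = 0 ∧ 0 < level g
  level_edge : ∀ a b, c.edge a b → level b = level a + 1
  num_inj : ∀ a b, level a = level b → num a = num b → a = b
  num_input : ∀ g i, c.kind g = GateKind.input i → num g = i
  num_negInput : ∀ g i, c.kind g = GateKind.negInput i → num g = n + i
  level_eq_iff : ∀ g, level g = d ↔ ∃ j, c.out j = g
  num_out : ∀ j, num (c.out j) = j
  edge_of_num : ∀ a b a' b', c.edge a' b' → num a' = num a → num b' = num b →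
    level b = level a + 1 → c.edge a b

/-- The gate numbers are polynomially bounded. -/
def PolyNumbered {C : (n : ℕ) → Circuit n} {d : ℕ} (N : (n : ℕ) → NormalForm (C n) d) : Prop :=
  ∃ k : ℕ, ∀ n (g : (C n).Gate), (N n).num g ≤ n ^ k + k

open Classical in
/-- The characteristic function of a relation on `ℕ`. -/
noncomputable def charFun {p : ℕ} (R : (Fin p → ℕ) → Prop) (v : Fin p → ℕ) : ℤ :=
  if R v then 1 else 0

/-- The functions `C(x, α, β)`, `L₀ⁱⁿ(x, t)`, `L₀^¬(x, t)` and `Lₑ(x, t)` for `1 ≤ e ≤ d`, which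
describe, for `n = Nat.size x`, the graph of the circuit `C n` and the levels of its gates. -/
inductive CircFun {C : (n : ℕ) → Circuit n} {d : ℕ} (N : (n : ℕ) → NormalForm (C n) d) :
    (p : ℕ) → ((Fin p → ℕ) → ℤ) → Prop
  | graph : CircFun N 3 (charFun fun v => ∃ a b : (C (Nat.size (v 0))).Gate,
      (C (Nat.size (v 0))).edge a b ∧
        (N (Nat.size (v 0))).num a = v 1 ∧ (N (Nat.size (v 0))).num b = v 2)
  | levelInput : CircFun N 2 (charFun fun v => ∃ a : (C (Nat.size (v 0))).Gate,
      (∃ i, (C (Nat.size (v 0))).kind a = GateKind.input i) ∧ (N (Nat.size (v 0))).num a = v 1)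
  | levelNeg : CircFun N 2 (charFun fun v => ∃ a : (C (Nat.size (v 0))).Gate,
      (∃ i, (C (Nat.size (v 0))).kind a = GateKind.negInput i) ∧ (N (Nat.size (v 0))).num a = v 1)
  | level (e : ℕ) (he : 1 ≤ e) (hed : e ≤ d) :
      CircFun N 2 (charFun fun v => ∃ a : (C (Nat.size (v 0))).Gate,
        (N (Nat.size (v 0))).level a = e ∧ (N (Nat.size (v 0))).num a = v 1)

/-! ## The function algebra -/

/-- The sign function on `ℤ`. -/
def sgInt (z : ℤ) : ℤ := if 0 < z then 1 else 0

/-- `f` solves the initial value problem `f(0, y) = g(y)`, `∂f(x, y)/∂ℓ = h(x, y, f(x, y))`, where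
`ℓ` is the binary length, that is,
`f(x + 1, y) = f(x, y) + (ℓ(x + 1) - ℓ(x)) * h(x, y, f(x, y))`. -/
def IsLengthODESolution {p : ℕ} (g : (Fin p → ℕ) → ℤ) (h : ℕ → (Fin p → ℕ) → ℤ → ℤ)
    (f : (Fin (p + 1) → ℕ) → ℤ) : Prop :=
  (∀ y, f (Fin.cons 0 y) = g y) ∧
  ∀ (x : ℕ) (y : Fin p → ℕ), f (Fin.cons (x + 1) y) = f (Fin.cons x y) +
    ((Nat.size (x + 1) : ℤ) - (Nat.size x : ℤ)) * h x y (f (Fin.cons x y))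

/-- The smallest class of functions `ℕ ^ p → ℤ` that contains the basic functions `0`, `1`, `sg`,
`ℓ`, `+`, `-`, `÷2`, `#`, `BIT`, the projections and the functions in `B`, and is closed under
composition, `ℓ-ODE₁` and `ℓ-2ODE`. The functions `+`, `-`, `sg`, `÷2` act on `ℤ`, so that they can
be composed with all functions of the class (the constructors `add`, `sub`, `sg`, `half`); all other
functions take natural arguments and can be composed with functions with natural values (`comp`). -/
inductive InAlgebra (B : (p : ℕ) → ((Fin p → ℕ) → ℤ) → Prop) :
    (p : ℕ) → ((Fin p → ℕ) → ℤ) → Prop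
  | base {p : ℕ} {f : (Fin p → ℕ) → ℤ} : B p f → InAlgebra B p f
  | zero : InAlgebra B 0 (fun _ => 0)
  | one : InAlgebra B 0 (fun _ => 1)
  | proj {p : ℕ} (i : Fin p) : InAlgebra B p (fun v => (v i : ℤ))
  | length : InAlgebra B 1 (fun v => (Nat.size (v 0) : ℤ))
  | smash : InAlgebra B 2 (fun v => ((2 ^ (Nat.size (v 0) * Nat.size (v 1)) : ℕ) : ℤ))
  | bit : InAlgebra B 2 (fun v => ((v 1 / 2 ^ v 0 % 2 : ℕ) : ℤ))
  | add {p : ℕ} {f g : (Fin p → ℕ) → ℤ} :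
      InAlgebra B p f → InAlgebra B p g → InAlgebra B p (fun v => f v + g v)
  | sub {p : ℕ} {f g : (Fin p → ℕ) → ℤ} :
      InAlgebra B p f → InAlgebra B p g → InAlgebra B p (fun v => f v - g v)
  | sg {p : ℕ} {f : (Fin p → ℕ) → ℤ} : InAlgebra B p f → InAlgebra B p (fun v => sgInt (f v))
  | half {p : ℕ} {f : (Fin p → ℕ) → ℤ} : InAlgebra B p f → InAlgebra B p (fun v => f v / 2)
  | comp {m p : ℕ} {f : (Fin m → ℕ) → ℤ} {g : Fin m → (Fin p → ℕ) → ℕ} :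
      InAlgebra B m f → (∀ i, InAlgebra B p (fun v => (g i v : ℤ))) →
        InAlgebra B p (fun v => f (fun i => g i v))
  | lengthODE1 {p : ℕ} {g : (Fin p → ℕ) → ℕ} {k : (Fin (p + 1) → ℕ) → ℕ}
      {f : (Fin (p + 1) → ℕ) → ℤ} :
      InAlgebra B p (fun y => (g y : ℤ)) → InAlgebra B (p + 1) (fun v => (k v : ℤ)) →
        (∀ v, k v ≤ 1) →
        IsLengthODESolution (fun y => (g y : ℤ)) (fun x y z => z + (k (Fin.cons x y) : ℤ)) f →
        InAlgebra B (p + 1) f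
  | length2ODE {p : ℕ} {g : (Fin p → ℕ) → ℕ} {k : (Fin (p + 1) → ℕ) → ℕ}
      {f : (Fin (p + 1) → ℕ) → ℤ} :
      InAlgebra B p (fun y => (g y : ℤ)) → InAlgebra B (p + 1) (fun v => (k v : ℤ)) →
        (∀ y, g y ≤ 1) → (∀ v, k v ≤ 1) →
        IsLengthODESolution (fun y => (g y : ℤ))
          (fun x y z => -2 * (k (Fin.cons x y) : ℤ) * z + (k (Fin.cons x y) : ℤ)) f →
        InAlgebra B (p + 1) f

/-!
**Evaluation in the algebra.** The length of a number increases by one at each power of `2` and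
nowhere else, so a length ODE started at `z = 0` runs for `Nat.size z` steps. The schema `ℓ-ODE₁`
maps `f` to `2 * f + k` in each step, so it computes the number with a given string of binary digits
(`NatMem.sum_two_pow_rev`), and the sign of that number is an existential quantifier over the
positions in the string (`RelMem.exists_lt`). The schema `ℓ-2ODE` replaces `f` by `1 - f` in each
step with `k = 1`, so it computes a parity (`RelMem.odd_ncard`). The smash function provides numbers
whose length exceeds all gate numbers (`exists_natMem_size_gt`). With these tools the values on the
levels of a normal form are computed one level after the other: an `or` gate is an existential
quantifier over gate numbers, an `and` gate a negated one, a `mod2` gate a parity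
(`relMem_levelVal`). There are only `d` levels, so this is a finite number of compositions. The
gates of the last level are the digits of the result.

**Normal form.** Let `D` bound the lengths of the paths of a circuit, and let `E > 3 * D + 3` be a
multiple of `3`. The layered circuit (`Circuit.layered`) has a copy of every gate on each of the
levels `1, …, E`. On the levels of the right type a copy is computed from the copies of the
predecessors on the level below, on all others it repeats the copy below; a negation is the sum
modulo `2` with a constant `1`, which is an `and` gate without predecessors. By induction on the
height, the copies of a gate of height `h` have the right value above level `3 * h + 3`
(`Circuit.val_layered_of_heightLE`). The outputs are `or` gates on level `E + 1`. The numbers of the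
gates on the levels `1, …, E` are distinct from all other numbers, and each edge has an endpoint on
one of these levels, so the numbers determine the edges.
-/

/-! ### Closure properties of the algebra -/

/-- The function `f : ℕ ^ p → ℕ` belongs to the algebra generated by `B`. -/
def NatMem (B : (p : ℕ) → ((Fin p → ℕ) → ℤ) → Prop) {p : ℕ} (f : (Fin p → ℕ) → ℕ) : Prop :=
  InAlgebra B p (fun v => (f v : ℤ))

/-- The characteristic function of the relation `R` belongs to the algebra generated by `B`. -/
def RelMem (B : (p : ℕ) → ((Fin p → ℕ) → ℤ) → Prop) {p : ℕ} (R : (Fin p → ℕ) → Prop) : Prop :=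
  InAlgebra B p (charFun R)

/-- The truth value of a proposition, as a natural number. -/
noncomputable def truth (P : Prop) : ℕ := by
  classical exact if P then 1 else 0

theorem truth_of_true {P : Prop} (h : P) : truth P = 1 := by simp [truth, h]

theorem truth_of_not {P : Prop} (h : ¬P) : truth P = 0 := by simp [truth, h]

theorem truth_le_one (P : Prop) : truth P ≤ 1 := by
  by_cases h : P <;> simp [truth, h]

theorem charFun_eq_truth {p : ℕ} (R : (Fin p → ℕ) → Prop) (v : Fin p → ℕ) :
    charFun R v = (truth (R v) : ℤ) := by
  by_cases h : R v <;> simp [truth, charFun, h]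

section Closure

variable {B : (p : ℕ) → ((Fin p → ℕ) → ℤ) → Prop} {p : ℕ}

theorem RelMem.natMem {R : (Fin p → ℕ) → Prop} (hR : RelMem B R) :
    NatMem B (fun v => truth (R v)) := by
  have h : (fun v => (truth (R v) : ℤ)) = charFun R := by
    funext v
    rw [charFun_eq_truth]
  rw [NatMem, h]
  exact hR

theorem RelMem.of_eq {R : (Fin p → ℕ) → Prop} {F : (Fin p → ℕ) → ℤ} (hF : InAlgebra B p F)
    (h : ∀ v, F v = (truth (R v) : ℤ)) : RelMem B R := by
  have h' : charFun R = F := by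
    funext v
    rw [charFun_eq_truth, h]
  rwa [RelMem, h']

theorem RelMem.congr {R S : (Fin p → ℕ) → Prop} (hR : RelMem B R) (h : ∀ v, R v ↔ S v) :
    RelMem B S := by
  have h' : R = S := funext fun v => propext (h v)
  exact h' ▸ hR

theorem NatMem.const (c : ℕ) : NatMem B (fun _ : Fin p → ℕ => c) := by
  induction c with
  | zero => exact InAlgebra.comp (g := fun i => i.elim0) InAlgebra.zero (fun i => i.elim0)
  | succ c ih =>
    have h1 : InAlgebra B p (fun _ => 1) :=
      InAlgebra.comp (g := fun i => i.elim0) InAlgebra.one (fun i => i.elim0)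
    simpa [NatMem] using InAlgebra.add ih h1

theorem NatMem.proj (i : Fin p) : NatMem B (fun v => v i) := InAlgebra.proj i

theorem NatMem.add {f g : (Fin p → ℕ) → ℕ} (hf : NatMem B f) (hg : NatMem B g) :
    NatMem B (fun v => f v + g v) := by
  simpa [NatMem] using InAlgebra.add hf hg

theorem NatMem.size {f : (Fin p → ℕ) → ℕ} (hf : NatMem B f) :
    NatMem B (fun v => Nat.size (f v)) :=
  InAlgebra.comp (g := fun _ => f) InAlgebra.length (fun _ => hf)

theorem NatMem.smash {f g : (Fin p → ℕ) → ℕ} (hf : NatMem B f) (hg : NatMem B g) :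
    NatMem B (fun v => 2 ^ (Nat.size (f v) * Nat.size (g v))) :=
  InAlgebra.comp (g := ![f, g]) InAlgebra.smash (Fin.forall_fin_two.2 ⟨hf, hg⟩)

theorem RelMem.comp {m : ℕ} {R : (Fin m → ℕ) → Prop} {g : Fin m → (Fin p → ℕ) → ℕ}
    (hR : RelMem B R) (hg : ∀ i, NatMem B (g i)) : RelMem B (fun v => R (fun i => g i v)) :=
  InAlgebra.comp (f := charFun R) hR hg

theorem RelMem.comp₂ {R : (Fin 2 → ℕ) → Prop} {f g : (Fin p → ℕ) → ℕ}
    (hR : RelMem B R) (hf : NatMem B f) (hg : NatMem B g) :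
    RelMem B (fun v => R ![f v, g v]) := by
  refine (hR.comp (g := ![f, g]) (Fin.forall_fin_two.2 ⟨hf, hg⟩)).congr fun v => ?_
  have h : (fun i => (![f, g] : Fin 2 → (Fin p → ℕ) → ℕ) i v) = ![f v, g v] := by
    funext i
    fin_cases i <;> rfl
  rw [h]

theorem RelMem.comp₃ {R : (Fin 3 → ℕ) → Prop} {f g h : (Fin p → ℕ) → ℕ}
    (hR : RelMem B R) (hf : NatMem B f) (hg : NatMem B g) (hh : NatMem B h) :
    RelMem B (fun v => R ![f v, g v, h v]) := by
  refine (hR.comp (g := ![f, g, h]) fun i => ?_).congr fun v => ?_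
  · fin_cases i
    exacts [hf, hg, hh]
  · have e : (fun i => (![f, g, h] : Fin 3 → (Fin p → ℕ) → ℕ) i v) = ![f v, g v, h v] := by
      funext i
      fin_cases i <;> rfl
    rw [e]

theorem RelMem.not {R : (Fin p → ℕ) → Prop} (hR : RelMem B R) : RelMem B (fun v => ¬R v) := by
  refine .of_eq (InAlgebra.sub (NatMem.const 1) hR.natMem) fun v => ?_
  by_cases h : R v <;> simp [truth, h]

theorem RelMem.or {R S : (Fin p → ℕ) → Prop} (hR : RelMem B R) (hS : RelMem B S) :
    RelMem B (fun v => R v ∨ S v) := by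
  refine .of_eq (InAlgebra.sg (InAlgebra.add hR.natMem hS.natMem)) fun v => ?_
  by_cases h : R v <;> by_cases h' : S v <;> simp [truth, sgInt, h, h']

theorem RelMem.and {R S : (Fin p → ℕ) → Prop} (hR : RelMem B R) (hS : RelMem B S) :
    RelMem B (fun v => R v ∧ S v) :=
  (hR.not.or hS.not).not.congr fun v => by tauto

theorem RelMem.lt {f g : (Fin p → ℕ) → ℕ} (hf : NatMem B f) (hg : NatMem B g) :
    RelMem B (fun v => f v < g v) := by
  refine .of_eq (InAlgebra.sg (InAlgebra.sub hg hf)) fun v => ?_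
  by_cases h : f v < g v <;> simp [truth, sgInt, h]

theorem RelMem.eq {f g : (Fin p → ℕ) → ℕ} (hf : NatMem B f) (hg : NatMem B g) :
    RelMem B (fun v => f v = g v) :=
  ((RelMem.lt hf hg).or (.lt hg hf)).not.congr fun v => by omega

theorem RelMem.testBit {f g : (Fin p → ℕ) → ℕ} (hf : NatMem B f) (hg : NatMem B g) :
    RelMem B (fun v => (f v).testBit (g v) = true) := by
  have h : NatMem B (fun v => f v / 2 ^ g v % 2) :=
    InAlgebra.comp (g := ![g, f]) InAlgebra.bit (Fin.forall_fin_two.2 ⟨hg, hf⟩)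
  refine (RelMem.eq h (.const 1)).congr fun v => ?_
  rw [Nat.testBit_eq_decide_div_mod_eq, decide_eq_true_iff]

/-! ### Length recursion -/

/-- A function of the length of its first argument solves a length ODE as soon as it satisfies the
recursion on lengths. -/
theorem isLengthODESolution_of_length {g : (Fin p → ℕ) → ℤ} {h : ℕ → (Fin p → ℕ) → ℤ → ℤ}
    {F : ℕ → (Fin p → ℕ) → ℤ} (h0 : ∀ y, F 0 y = g y)
    (hs : ∀ x y, F (Nat.size x + 1) y = F (Nat.size x) y + h x y (F (Nat.size x) y)) :
    IsLengthODESolution g h (fun w => F (Nat.size (w 0)) (Fin.tail w)) := by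
  refine ⟨fun y => by simp [h0], fun x y => ?_⟩
  simp only [Fin.cons_zero, Fin.tail_cons]
  have h1 : Nat.size x ≤ Nat.size (x + 1) := Nat.size_le_size (Nat.le_succ x)
  have h2 : Nat.size (x + 1) ≤ Nat.size x + 1 := by
    rw [Nat.size_le]
    have := Nat.lt_size_self x
    have : 1 ≤ 2 ^ Nat.size x := Nat.one_le_two_pow
    rw [pow_succ]
    omega
  obtain h | h : Nat.size (x + 1) = Nat.size x ∨ Nat.size (x + 1) = Nat.size x + 1 := by omega
  · simp [h]
  · rw [h, hs]
    push_cast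
    ring

theorem NatMem.subst_cons {F : ℕ → (Fin p → ℕ) → ℕ} {b : (Fin p → ℕ) → ℕ}
    (hF : NatMem B (fun w : Fin (p + 1) → ℕ => F (w 0) (Fin.tail w))) (hb : NatMem B b) :
    NatMem B (fun v => F (b v) v) :=
  InAlgebra.comp (g := Fin.cons b fun i v => v i) hF (Fin.cases hb NatMem.proj)

theorem RelMem.lengthArg {R : ℕ → (Fin p → ℕ) → Prop}
    (hR : RelMem B (fun w : Fin (p + 1) → ℕ => R (w 0) (Fin.tail w))) :
    RelMem B (fun w : Fin (p + 1) → ℕ => R (Nat.size (w 0)) (Fin.tail w)) :=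
  hR.comp (g := Fin.cons (fun w => Nat.size (w 0)) fun i w => w i.succ)
    (Fin.cases (.size (.proj 0)) fun i => .proj i.succ)

/-- The schema `ℓ-ODE₁` doubles and adds a bit at each increase of the length, so it computes the
number with a given string of binary digits, the most significant one first. -/
theorem NatMem.sum_two_pow_rev {R : ℕ → (Fin p → ℕ) → Prop} {b : (Fin p → ℕ) → ℕ}
    (hR : RelMem B (fun w : Fin (p + 1) → ℕ => R (w 0) (Fin.tail w))) (hb : NatMem B b) :
    NatMem B (fun v => ∑ i ∈ Finset.range (Nat.size (b v)),
      2 ^ (Nat.size (b v) - 1 - i) * truth (R i v)) := by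
  have hs : ∀ (m : ℕ) (y : Fin p → ℕ),
      ∑ i ∈ Finset.range (m + 1), 2 ^ (m + 1 - 1 - i) * truth (R i y) =
        2 * ∑ i ∈ Finset.range m, 2 ^ (m - 1 - i) * truth (R i y) + truth (R m y) := by
    intro m y
    rw [Finset.sum_range_succ, Finset.mul_sum]
    congr 1
    · refine Finset.sum_congr rfl fun i hi => ?_
      have hi' := Finset.mem_range.1 hi
      rw [← mul_assoc, ← pow_succ']
      congr 2
      omega
    · simp
  refine NatMem.subst_cons (F := fun z v => ∑ i ∈ Finset.range (Nat.size z),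
      2 ^ (Nat.size z - 1 - i) * truth (R i v)) ?_ hb
  refine InAlgebra.lengthODE1 (g := fun _ => 0) (NatMem.const 0) hR.lengthArg.natMem
    (fun _ => truth_le_one _) ?_
  refine isLengthODESolution_of_length
    (F := fun m y => ((∑ i ∈ Finset.range m, 2 ^ (m - 1 - i) * truth (R i y) : ℕ) : ℤ))
    (fun y => by simp) fun x y => ?_
  rw [hs]
  simp only [Fin.cons_zero, Fin.tail_cons]
  push_cast
  ring

/-- A number with binary digits `R i` is positive exactly when one of them is `1`, so the algebra
is closed under existential quantification up to a length. -/
theorem RelMem.exists_lt {R : ℕ → (Fin p → ℕ) → Prop} {b : (Fin p → ℕ) → ℕ}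
    (hR : RelMem B (fun w : Fin (p + 1) → ℕ => R (w 0) (Fin.tail w))) (hb : NatMem B b) :
    RelMem B (fun v => ∃ i < Nat.size (b v), R i v) := by
  refine (RelMem.lt (.const 0) (NatMem.sum_two_pow_rev hR hb)).congr fun v => ?_
  rw [Nat.pos_iff_ne_zero, Ne, Finset.sum_eq_zero_iff]
  constructor
  · intro h
    push Not at h
    obtain ⟨i, hi, hne⟩ := h
    refine ⟨i, Finset.mem_range.1 hi, ?_⟩
    by_contra hc
    simp [truth_of_not hc] at hne
  · rintro ⟨i, hi, hRi⟩ h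
    simpa [truth_of_true hRi] using h i (Finset.mem_range.2 hi)

/-- The least significant digit comes first here, so the string of digits is read backwards: digit
`i` of the reversed string is the digit `j` with `j + 1 + i` equal to the number of digits. -/
theorem NatMem.sum_two_pow {R : ℕ → (Fin p → ℕ) → Prop} {b : (Fin p → ℕ) → ℕ}
    (hR : RelMem B (fun w : Fin (p + 1) → ℕ => R (w 0) (Fin.tail w))) (hb : NatMem B b) :
    NatMem B (fun v => ∑ i ∈ Finset.range (Nat.size (b v)), 2 ^ i * truth (R i v)) := by
  have hb' : NatMem B (fun w : Fin (p + 1) → ℕ => b (Fin.tail w)) :=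
    InAlgebra.comp (g := fun i w => w i.succ) hb fun i => NatMem.proj i.succ
  have hb'' : NatMem B (fun w : Fin (p + 2) → ℕ => b (Fin.tail (Fin.tail w))) :=
    InAlgebra.comp (g := fun i w => w i.succ.succ) hb fun i => NatMem.proj i.succ.succ
  have hrev : RelMem B (fun w : Fin (p + 1) → ℕ => ∃ j < Nat.size (b (Fin.tail w)),
      j + 1 + w 0 = Nat.size (b (Fin.tail w)) ∧ R j (Fin.tail w)) := by
    refine RelMem.exists_lt (R := fun j w => j + 1 + w 0 = Nat.size (b (Fin.tail w)) ∧
      R j (Fin.tail w)) ?_ hb'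
    refine (RelMem.eq (((NatMem.proj 0).add (.const 1)).add (.proj 1)) hb''.size).and ?_
    exact hR.comp (g := Fin.cons (fun w => w 0) fun i w => w i.succ.succ)
      (Fin.cases (.proj 0) fun i => .proj i.succ.succ)
  have h := NatMem.sum_two_pow_rev (R := fun i v => ∃ j < Nat.size (b v),
      j + 1 + i = Nat.size (b v) ∧ R j v) hrev hb
  have e : (fun v => ∑ i ∈ Finset.range (Nat.size (b v)), 2 ^ i * truth (R i v)) =
      fun v => ∑ i ∈ Finset.range (Nat.size (b v)), 2 ^ (Nat.size (b v) - 1 - i) *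
        truth (∃ j < Nat.size (b v), j + 1 + i = Nat.size (b v) ∧ R j v) := by
    funext v
    rw [← Finset.sum_range_reflect]
    refine Finset.sum_congr rfl fun i hi => ?_
    have hi' := Finset.mem_range.1 hi
    congr 2
    refine propext ⟨fun hr => ⟨_, by omega, by omega, hr⟩, ?_⟩
    rintro ⟨j, -, hj, hr⟩
    obtain rfl : j = Nat.size (b v) - 1 - i := by omega
    exact hr
  rwa [e]

/-- The schema `ℓ-2ODE` flips its value at each increase of the length at which `k = 1`, so it
computes parities. -/
theorem RelMem.odd_ncard {R : ℕ → (Fin p → ℕ) → Prop} {b : (Fin p → ℕ) → ℕ}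
    (hR : RelMem B (fun w : Fin (p + 1) → ℕ => R (w 0) (Fin.tail w))) (hb : NatMem B b) :
    RelMem B (fun v => Odd {i | i < Nat.size (b v) ∧ R i v}.ncard) := by
  have hs : ∀ (m : ℕ) (y : Fin p → ℕ), {i | i < m + 1 ∧ R i y}.ncard =
      {i | i < m ∧ R i y}.ncard + truth (R m y) := by
    intro m y
    by_cases h : R m y
    · have e : {i | i < m + 1 ∧ R i y} = insert m {i | i < m ∧ R i y} := by
        ext i
        simp only [Set.mem_ofPred_eq, Set.mem_insert_iff, Nat.lt_succ_iff_lt_or_eq]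
        constructor
        · tauto
        · rintro (rfl | h') <;> tauto
      rw [e, truth_of_true h, Set.ncard_insert_of_notMem (by simp)
        ((Set.finite_lt_nat m).subset fun i hi => hi.1)]
    · have e : {i | i < m + 1 ∧ R i y} = {i | i < m ∧ R i y} := by
        ext i
        simp only [Set.mem_ofPred_eq, Nat.lt_succ_iff_lt_or_eq]
        constructor
        · rintro ⟨h1 | rfl, h2⟩ <;> tauto
        · tauto
      rw [e, truth_of_not h, add_zero]
  have key : NatMem B (fun v => {i | i < Nat.size (b v) ∧ R i v}.ncard % 2) := by
    refine NatMem.subst_cons (F := fun z v => {i | i < Nat.size z ∧ R i v}.ncard % 2) ?_ hb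
    refine InAlgebra.length2ODE (g := fun _ => 0) (NatMem.const 0) hR.lengthArg.natMem
      (fun _ => zero_le_one) (fun _ => truth_le_one _) ?_
    refine isLengthODESolution_of_length
      (F := fun m y => (({i | i < m ∧ R i y}.ncard % 2 : ℕ) : ℤ)) (fun y => by simp) fun x y => ?_
    rw [hs]
    simp only [Fin.cons_zero, Fin.tail_cons]
    obtain h | h := Nat.le_one_iff_eq_zero_or_eq_one.1 (truth_le_one (R (Nat.size x) y))
    · simp [h]
    · rw [h]
      push_cast
      omega
  exact (RelMem.eq key (.const 1)).congr fun v => Nat.odd_iff.symm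

/-- Iterating the smash function gives numbers of any polynomial length. -/
theorem exists_natMem_size_gt {f : (Fin p → ℕ) → ℕ} (hf : NatMem B f) (k : ℕ) :
    ∃ b : (Fin p → ℕ) → ℕ, NatMem B b ∧ ∀ v, Nat.size (f v) ^ k + k < Nat.size (b v) := by
  have hpow : ∃ b : (Fin p → ℕ) → ℕ, NatMem B b ∧ ∀ v, Nat.size (f v) ^ k ≤ Nat.size (b v) := by
    induction k with
    | zero => exact ⟨_, .const 1, fun v => by simp⟩
    | succ k ih =>
      obtain ⟨b, hb, h⟩ := ih
      refine ⟨_, hb.smash hf, fun v => ?_⟩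
      rw [Nat.size_pow, pow_succ]
      exact (Nat.mul_le_mul_right _ (h v)).trans (Nat.le_succ _)
  obtain ⟨b, hb, h⟩ := hpow
  obtain ⟨b', hb', h'⟩ : ∃ b' : (Fin p → ℕ) → ℕ, NatMem B b' ∧
      ∀ v, Nat.size (b v) + k + 1 ≤ Nat.size (b' v) := by
    -- the length of `b # 2 ^ (k + 1)` is `ℓ(b) * (k + 2) + 1`; adding `1` makes `ℓ(b)` positive
    refine ⟨_, (hb.add (.const 1)).smash (.const (2 ^ (k + 1))), fun v => ?_⟩
    rw [Nat.size_pow, Nat.size_pow]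
    have h1 : Nat.size (b v) ≤ Nat.size (b v + 1) := Nat.size_le_size (Nat.le_succ _)
    have h2 : 0 < Nat.size (b v + 1) := Nat.size_pos.2 (Nat.succ_pos _)
    nlinarith
  exact ⟨b', hb', fun v => by have := h v; have := h' v; omega⟩

end Closure

/-! ### Values of gates -/

namespace Circuit

section Val

variable {n : ℕ} (c : Circuit n) (x : Fin n → Bool) {b : c.Gate}

theorem val_of_input {i : Fin n} (h : c.kind b = GateKind.input i) : c.val x b = x i := by
  rw [val_eq, gateOp, h]

theorem val_of_negInput {i : Fin n} (h : c.kind b = GateKind.negInput i) :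
    c.val x b = !(x i) := by
  rw [val_eq, gateOp, h]

theorem val_of_not (h : c.kind b = GateKind.not) :
    c.val x b = true ↔ ∀ a, c.edge a b → c.val x a = false := by
  rw [val_eq, gateOp, h]
  simp

theorem val_of_and (h : c.kind b = GateKind.and) :
    c.val x b = true ↔ ∀ a, c.edge a b → c.val x a = true := by
  rw [val_eq, gateOp, h]
  simp

theorem val_of_or (h : c.kind b = GateKind.or) :
    c.val x b = true ↔ ∃ a, c.edge a b ∧ c.val x a = true := by
  rw [val_eq, gateOp, h]
  simp

theorem val_of_mod2 (h : c.kind b = GateKind.mod2) :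
    c.val x b = true ↔ Odd {a | c.edge a b ∧ c.val x a = true}.ncard := by
  classical
  rw [val_eq, gateOp, h]
  have e : {a | c.edge a b ∧ c.val x a = true}.ncard =
      ∑ a : {a : c.Gate // c.edge a b}, (c.val x a.1).toNat := by
    rw [← Finset.sum_subtype (Finset.univ.filter fun a => c.edge a b) (by simp)
      (fun a => (c.val x a).toNat)]
    have e' : {a | c.edge a b ∧ c.val x a = true} =
        ↑((Finset.univ.filter fun a => c.edge a b).filter fun a => c.val x a = true) := by
      ext a
      simp
    rw [e', Set.ncard_coe_finset, Finset.card_filter]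
    refine Finset.sum_congr rfl fun a _ => ?_
    cases c.val x a <;> rfl
  rw [e, Nat.odd_iff, decide_eq_true_iff]

/-- A gate with a single predecessor, other than a negation, transmits its value. -/
theorem val_eq_of_edge_iff_eq {a : c.Gate}
    (hk : c.kind b = GateKind.or ∨ c.kind b = GateKind.and ∨ c.kind b = GateKind.mod2)
    (h : ∀ a', c.edge a' b ↔ a' = a) : c.val x b = c.val x a := by
  rw [Bool.eq_iff_iff]
  obtain hk | hk | hk := hk
  · simp [c.val_of_or x hk, h]
  · simp [c.val_of_and x hk, h]
  · rw [c.val_of_mod2 x hk]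
    simp only [h]
    cases hv : c.val x a
    · have e : {a' | a' = a ∧ c.val x a' = true} = ∅ := by
        ext a'
        simp only [Set.mem_ofPred_eq, Set.mem_empty_iff_false, iff_false]
        rintro ⟨rfl, h'⟩
        simp [hv] at h'
      simp [e]
    · have e : {a' | a' = a ∧ c.val x a' = true} = {a} := by
        ext a'
        simp only [Set.mem_ofPred_eq, Set.mem_singleton_iff]
        exact ⟨And.left, by rintro rfl; exact ⟨rfl, hv⟩⟩
      simp [e]

/-- If the predecessors of `b` are the copies of those of `g`, and the copies have the same values,
then `b` has the value of `g`. -/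
theorem val_eq_of_copies {c' : Circuit n} {g : c.Gate} {b : c'.Gate} {φ : c.Gate → c'.Gate}
    (hφ : Function.Injective φ)
    (hg : c.kind g = GateKind.or ∨ c.kind g = GateKind.and ∨ c.kind g = GateKind.mod2)
    (hb : c'.kind b = c.kind g) (hedge : ∀ a', c'.edge a' b ↔ ∃ a, c.edge a g ∧ φ a = a')
    (hval : ∀ a, c.edge a g → c'.val x (φ a) = c.val x a) : c'.val x b = c.val x g := by
  rw [Bool.eq_iff_iff]
  obtain hk | hk | hk := hg
  · rw [c'.val_of_or x (hb.trans hk), c.val_of_or x hk]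
    simp only [hedge]
    constructor
    · rintro ⟨_, ⟨a, ha, rfl⟩, h⟩
      exact ⟨a, ha, (hval a ha).symm.trans h⟩
    · rintro ⟨a, ha, h⟩
      exact ⟨_, ⟨a, ha, rfl⟩, (hval a ha).trans h⟩
  · rw [c'.val_of_and x (hb.trans hk), c.val_of_and x hk]
    simp only [hedge]
    constructor
    · exact fun h a ha => (hval a ha).symm.trans (h _ ⟨a, ha, rfl⟩)
    · rintro h _ ⟨a, ha, rfl⟩
      exact (hval a ha).trans (h a ha)
  · rw [c'.val_of_mod2 x (hb.trans hk), c.val_of_mod2 x hk, ← Set.ncard_image_of_injective _ hφ]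
    simp only [hedge]
    suffices e : {a' | (∃ a, c.edge a g ∧ φ a = a') ∧ c'.val x a' = true} =
        φ '' {a | c.edge a g ∧ c.val x a = true} by rw [e]
    ext a'
    constructor
    · rintro ⟨⟨a, ha, rfl⟩, h⟩
      exact ⟨a, ⟨ha, (hval a ha).symm.trans h⟩, rfl⟩
    · rintro ⟨a, ⟨ha, h⟩, rfl⟩
      exact ⟨⟨a, ha, rfl⟩, (hval a ha).trans h⟩

/-- The sum modulo `2` of a bit and the constant `1` is the negation of the bit. -/
theorem val_eq_not_of_mod2 {a one : c.Gate} (hb : c.kind b = GateKind.mod2) (hne : a ≠ one)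
    (hone : c.val x one = true) (hedge : ∀ a', c.edge a' b ↔ a' = a ∨ a' = one) :
    c.val x b = !(c.val x a) := by
  rw [Bool.eq_iff_iff, c.val_of_mod2 x hb]
  simp only [hedge]
  cases hv : c.val x a
  · have e : {a' | (a' = a ∨ a' = one) ∧ c.val x a' = true} = {one} := by
      ext a'
      simp only [Set.mem_ofPred_eq, Set.mem_singleton_iff]
      constructor
      · rintro ⟨rfl | rfl, h⟩
        · simp [hv] at h
        · rfl
      · rintro rfl
        exact ⟨.inr rfl, hone⟩
    simp [e]
  · have e : {a' | (a' = a ∨ a' = one) ∧ c.val x a' = true} = {a, one} := by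
      ext a'
      simp only [Set.mem_ofPred_eq, Set.mem_singleton_iff, Set.mem_insert_iff]
      constructor
      · exact And.left
      · rintro (rfl | rfl)
        · exact ⟨.inl rfl, hv⟩
        · exact ⟨.inr rfl, hone⟩
    rw [e, Set.ncard_pair hne]
    simp

end Val

end Circuit

/-! ### Evaluating a normal form in the algebra -/

section Evaluation

variable {C : (n : ℕ) → Circuit n} {d : ℕ} (N : (n : ℕ) → NormalForm (C n) d)

/-- The gate with number `t` on level `e` of `C n`, for `n = Nat.size x`, exists and has value `1`
on the binary digits of `x`. -/
def LevelVal (e : ℕ) (x t : ℕ) : Prop :=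
  ∃ a : (C (Nat.size x)).Gate, (N (Nat.size x)).level a = e ∧ (N (Nat.size x)).num a = t ∧
    (C (Nat.size x)).val (fun i => x.testBit i) a = true

/-- Level `e` of `C n`, for `n = Nat.size x`, has a gate with number `t`. -/
def LevelNum (e : ℕ) (x t : ℕ) : Prop :=
  ∃ a : (C (Nat.size x)).Gate, (N (Nat.size x)).level a = e ∧ (N (Nat.size x)).num a = t

/-- Some edge of `C n`, for `n = Nat.size x`, joins gates with the numbers `s` and `t`. -/
def EdgeNum (x s t : ℕ) : Prop :=
  ∃ a b : (C (Nat.size x)).Gate, (C (Nat.size x)).edge a b ∧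
    (N (Nat.size x)).num a = s ∧ (N (Nat.size x)).num b = t

variable {N}

theorem levelVal_iff_of_num {e x : ℕ} {a : (C (Nat.size x)).Gate}
    (ha : (N (Nat.size x)).level a = e) :
    LevelVal N e x ((N (Nat.size x)).num a) ↔
      (C (Nat.size x)).val (fun i => x.testBit i) a = true := by
  constructor
  · rintro ⟨a', h1, h2, h3⟩
    rwa [← (N (Nat.size x)).num_inj a' a (h1.trans ha.symm) h2]
  · exact fun h => ⟨a, ha, rfl, h⟩

/-- On consecutive levels the numbers determine the edges. -/
theorem edgeNum_iff {x : ℕ} {a b : (C (Nat.size x)).Gate}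
    (h : (N (Nat.size x)).level b = (N (Nat.size x)).level a + 1) :
    EdgeNum N x ((N (Nat.size x)).num a) ((N (Nat.size x)).num b) ↔
      (C (Nat.size x)).edge a b := by
  constructor
  · rintro ⟨a', b', he, ha, hb⟩
    exact (N (Nat.size x)).edge_of_num a b a' b' he ha hb h
  · exact fun he => ⟨a, b, he, rfl, rfl⟩

theorem NormalForm.kind_of_level_zero {n : ℕ} {c : Circuit n} (M : NormalForm c d) {a : c.Gate}
    (h : M.level a = 0) :
    (∃ i, c.kind a = GateKind.input i) ∨ ∃ i, c.kind a = GateKind.negInput i := by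
  rcases hk : c.kind a with i | i | _ | _ | _ | _
  · exact .inl ⟨i, rfl⟩
  · exact .inr ⟨i, rfl⟩
  · exact absurd hk (M.no_not a)
  · have := M.level_and a hk
    omega
  · have := M.level_or a hk
    omega
  · have := M.level_mod2 a hk
    omega

theorem NormalForm.kind_of_level_succ {n : ℕ} {c : Circuit n} (M : NormalForm c d) {a : c.Gate}
    {e : ℕ} (h : M.level a = e + 1) :
    c.kind a = if (e + 1) % 3 = 1 then GateKind.or else
      if (e + 1) % 3 = 2 then GateKind.and else GateKind.mod2 := by
  rcases hk : c.kind a with i | i | _ | _ | _ | _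
  · have := M.level_input a i hk
    omega
  · have := M.level_negInput a i hk
    omega
  · exact absurd hk (M.no_not a)
  · have := M.level_and a hk
    rw [if_neg (by omega), if_pos (by omega)]
  · have := M.level_or a hk
    rw [if_pos (by omega)]
  · have := M.level_mod2 a hk
    rw [if_neg (by omega), if_neg (by omega)]

theorem relMem_edgeNum :
    RelMem (CircFun N) (fun v : Fin 3 → ℕ => EdgeNum N (v 0) (v 1) (v 2)) :=
  InAlgebra.base CircFun.graph

theorem relMem_levelInput : RelMem (CircFun N) (fun v : Fin 2 → ℕ =>
    ∃ a : (C (Nat.size (v 0))).Gate, (∃ i, (C (Nat.size (v 0))).kind a = GateKind.input i) ∧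
      (N (Nat.size (v 0))).num a = v 1) :=
  InAlgebra.base CircFun.levelInput

theorem relMem_levelNeg : RelMem (CircFun N) (fun v : Fin 2 → ℕ =>
    ∃ a : (C (Nat.size (v 0))).Gate, (∃ i, (C (Nat.size (v 0))).kind a = GateKind.negInput i) ∧
      (N (Nat.size (v 0))).num a = v 1) :=
  InAlgebra.base CircFun.levelNeg

theorem relMem_levelNum {e : ℕ} (hed : e ≤ d) :
    RelMem (CircFun N) (fun v : Fin 2 → ℕ => LevelNum N e (v 0) (v 1)) := by
  obtain rfl | he := Nat.eq_zero_or_pos e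
  · refine (relMem_levelInput.or relMem_levelNeg).congr fun v => ?_
    constructor
    · rintro (⟨a, ⟨i, hi⟩, ha⟩ | ⟨a, ⟨i, hi⟩, ha⟩)
      · exact ⟨a, (N _).level_input a i hi, ha⟩
      · exact ⟨a, (N _).level_negInput a i hi, ha⟩
    · rintro ⟨a, h0, ha⟩
      exact ((N _).kind_of_level_zero h0).imp (fun h => ⟨a, h, ha⟩) fun h => ⟨a, h, ha⟩
  · exact InAlgebra.base (CircFun.level e he hed)

theorem relMem_levelVal_zero :
    RelMem (CircFun N) (fun v : Fin 2 → ℕ => LevelVal N 0 (v 0) (v 1)) := by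
  -- the digit read by the negated input with number `t` is the `i` with `i + Nat.size x = t`
  have hneg : RelMem (CircFun N) (fun v : Fin 2 → ℕ =>
      ∃ i < Nat.size (v 0), i + Nat.size (v 0) = v 1 ∧ ¬(v 0).testBit i = true) := by
    refine RelMem.exists_lt
      (R := fun i v => i + Nat.size (v 0) = v 1 ∧ ¬(v 0).testBit i = true) ?_ (.proj 0)
    exact (RelMem.eq (p := 3) ((NatMem.proj 0).add (NatMem.proj 1).size) (.proj 2)).and
      (RelMem.testBit (.proj 1) (.proj 0)).not
  refine ((relMem_levelInput.and (.testBit (.proj 0) (.proj 1))).or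
    (relMem_levelNeg.and hneg)).congr fun v => ?_
  constructor
  · rintro (⟨⟨a, ⟨i, hi⟩, ha⟩, hv⟩ | ⟨⟨a, ⟨i, hi⟩, ha⟩, j, -, hj, hv⟩)
    · refine ⟨a, (N _).level_input a i hi, ha, ?_⟩
      rw [Circuit.val_of_input _ _ hi, ← (N _).num_input a i hi, ha]
      exact hv
    · refine ⟨a, (N _).level_negInput a i hi, ha, ?_⟩
      have := (N _).num_negInput a i hi
      obtain rfl : j = i := by omega
      rw [Circuit.val_of_negInput _ _ hi]
      simpa using hv
  · rintro ⟨a, h0, ha, hv⟩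
    obtain ⟨i, hi⟩ | ⟨i, hi⟩ := (N _).kind_of_level_zero h0
    · refine .inl ⟨⟨a, ⟨i, hi⟩, ha⟩, ?_⟩
      rwa [Circuit.val_of_input _ _ hi, ← (N _).num_input a i hi, ha] at hv
    · refine .inr ⟨⟨a, ⟨i, hi⟩, ha⟩, i, i.2, ?_, ?_⟩
      · rw [add_comm, ← (N _).num_negInput a i hi, ha]
      · rw [Circuit.val_of_negInput _ _ hi] at hv
        simpa using hv

/-- The values on a level are obtained from those on the previous level by a quantification or a
count over the gate numbers, all of which are below the length of `b`. -/
theorem relMem_levelVal {b : (Fin 2 → ℕ) → ℕ} (hb : NatMem (CircFun N) b)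
    (hN : ∀ (v : Fin 2 → ℕ) (a : (C (Nat.size (v 0))).Gate),
      (N (Nat.size (v 0))).num a < Nat.size (b v)) (e : ℕ) (hed : e ≤ d) :
    RelMem (CircFun N) (fun v : Fin 2 → ℕ => LevelVal N e (v 0) (v 1)) := by
  induction e with
  | zero => exact relMem_levelVal_zero
  | succ e ih =>
    have hval : RelMem (CircFun N) (fun w : Fin 3 → ℕ => LevelVal N e (w 1) (w 0)) :=
      (ih (by omega)).comp₂ (.proj 1) (.proj 0)
    have hnum : RelMem (CircFun N) (fun w : Fin 3 → ℕ => LevelNum N e (w 1) (w 0)) :=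
      (relMem_levelNum (by omega)).comp₂ (.proj 1) (.proj 0)
    have hedge : RelMem (CircFun N) (fun w : Fin 3 → ℕ => EdgeNum N (w 1) (w 0) (w 2)) :=
      relMem_edgeNum.comp₃ (.proj 1) (.proj 0) (.proj 2)
    -- it suffices to describe the value of the gate with a given number, if there is one
    have key : ∀ {R : (Fin 2 → ℕ) → Prop}, RelMem (CircFun N) R →
        (∀ (v : Fin 2 → ℕ) (g : (C (Nat.size (v 0))).Gate),
          (N (Nat.size (v 0))).level g = e + 1 → (N (Nat.size (v 0))).num g = v 1 →
          (R v ↔ (C (Nat.size (v 0))).val (fun i => (v 0).testBit i) g = true)) →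
        RelMem (CircFun N) (fun v : Fin 2 → ℕ => LevelVal N (e + 1) (v 0) (v 1)) := by
      intro R hR h
      refine ((relMem_levelNum hed).and hR).congr fun v => ?_
      constructor
      · rintro ⟨⟨g, hl, hn⟩, hr⟩
        exact ⟨g, hl, hn, (h v g hl hn).1 hr⟩
      · rintro ⟨g, hl, hn, hv⟩
        exact ⟨⟨g, hl, hn⟩, (h v g hl hn).2 hv⟩
    obtain h3 | h3 | h3 : (e + 1) % 3 = 1 ∨ (e + 1) % 3 = 2 ∨ (e + 1) % 3 = 0 := by omega
    · refine key (RelMem.exists_lt (R := fun s v => LevelVal N e (v 0) s ∧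
        EdgeNum N (v 0) s (v 1)) (hval.and hedge) hb) fun v g hl hn => ?_
      have hk := (N _).kind_of_level_succ hl
      rw [if_pos h3] at hk
      rw [Circuit.val_of_or _ _ hk, ← hn]
      constructor
      · rintro ⟨s, -, ⟨a, hal, rfl, hav⟩, hs⟩
        exact ⟨a, (edgeNum_iff (by rw [hl, hal])).1 hs, hav⟩
      · rintro ⟨a, hag, hav⟩
        have hal := (N _).level_edge a g hag
        exact ⟨_, hN v a, ⟨a, by omega, rfl, hav⟩, (edgeNum_iff hal).2 hag⟩
    · refine key (RelMem.exists_lt (R := fun s v => LevelNum N e (v 0) s ∧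
        ¬LevelVal N e (v 0) s ∧ EdgeNum N (v 0) s (v 1))
        (hnum.and (hval.not.and hedge)) hb).not fun v g hl hn => ?_
      have hk := (N _).kind_of_level_succ hl
      rw [if_neg (by omega), if_pos h3] at hk
      rw [Circuit.val_of_and _ _ hk, ← hn]
      constructor
      · intro h a hag
        have hal := (N _).level_edge a g hag
        by_contra hav
        exact h ⟨_, hN v a, ⟨a, by omega, rfl⟩,
          fun h' => hav ((levelVal_iff_of_num (by omega)).1 h'), (edgeNum_iff hal).2 hag⟩
      · rintro h ⟨s, -, ⟨a, hal, rfl⟩, hav, hs⟩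
        exact hav ⟨a, hal, rfl, h a ((edgeNum_iff (by rw [hl, hal])).1 hs)⟩
    · refine key (RelMem.odd_ncard (R := fun s v => LevelVal N e (v 0) s ∧
        EdgeNum N (v 0) s (v 1)) (hval.and hedge) hb) fun v g hl hn => ?_
      have hk := (N _).kind_of_level_succ hl
      rw [if_neg (by omega), if_neg (by omega)] at hk
      rw [Circuit.val_of_mod2 _ _ hk, ← hn]
      -- the numbers of the predecessors of `g` with value `1` are pairwise distinct
      have himage : {s | s < Nat.size (b v) ∧ LevelVal N e (v 0) s ∧
          EdgeNum N (v 0) s ((N (Nat.size (v 0))).num g)} = (N (Nat.size (v 0))).num ''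
          {a | (C (Nat.size (v 0))).edge a g ∧
            (C (Nat.size (v 0))).val (fun i => (v 0).testBit i) a = true} := by
        ext s
        constructor
        · rintro ⟨-, ⟨a, hal, rfl, hav⟩, hs⟩
          exact ⟨a, ⟨(edgeNum_iff (by rw [hl, hal])).1 hs, hav⟩, rfl⟩
        · rintro ⟨a, ⟨hag, hav⟩, rfl⟩
          have hal := (N _).level_edge a g hag
          exact ⟨hN v a, ⟨a, by omega, rfl, hav⟩, (edgeNum_iff hal).2 hag⟩
      rw [himage, Set.InjOn.ncard_image]
      rintro a ⟨ha, -⟩ a' ⟨ha', -⟩ h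
      have h1 := (N _).level_edge a g ha
      have h2 := (N _).level_edge a' g ha'
      exact (N _).num_inj a a' (by omega) h

theorem outputNumber_eq_sum {x M : ℕ} (hM : (C (Nat.size x)).numOut ≤ M) :
    (C (Nat.size x)).outputNumber (fun i => x.testBit i) =
      ∑ j ∈ Finset.range M, 2 ^ j * truth (LevelVal N d x j) := by
  have hlevel : ∀ j, (N (Nat.size x)).level ((C (Nat.size x)).out j) = d :=
    fun j => ((N _).level_eq_iff _).2 ⟨j, rfl⟩
  have hzero : ∀ j ∈ Finset.range M, j ∉ Finset.range (C (Nat.size x)).numOut →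
      2 ^ j * truth (LevelVal N d x j) = 0 := by
    intro j _ hj
    rw [truth_of_not, mul_zero]
    rintro ⟨a, ha, rfl, -⟩
    obtain ⟨i, rfl⟩ := ((N _).level_eq_iff a).1 ha
    exact hj (Finset.mem_range.2 ((N _).num_out i ▸ i.2))
  rw [← Finset.sum_subset (Finset.range_subset_range.2 hM) hzero, Finset.sum_range,
    Circuit.outputNumber]
  refine Finset.sum_congr rfl fun j _ => ?_
  have h := levelVal_iff_of_num (N := N) (hlevel j)
  rw [(N _).num_out] at h
  rw [mul_comm]
  congr 1
  cases hv : (C (Nat.size x)).val (fun i => x.testBit i) ((C (Nat.size x)).out j)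
  · rw [truth_of_not (by rw [h, hv]; simp)]
    rfl
  · rw [truth_of_true (h.2 hv)]
    rfl

/-- The bound on the gate numbers makes all quantifiers range over lengths of numbers in the
algebra; the digits of `f x` are the values on the last level. -/
theorem inAlgebra_of_computes {f : ℕ → ℕ} (hN : PolyNumbered N) (hf : Computes C f) :
    InAlgebra (CircFun N) 1 (fun v => (f (v 0) : ℤ)) := by
  obtain ⟨k, hk⟩ := hN
  obtain ⟨b, hb, hsize⟩ :=
    exists_natMem_size_gt (B := CircFun N) (NatMem.proj (p := 1) 0) k
  have hnum : ∀ (v : Fin 1 → ℕ) (a : (C (Nat.size (v 0))).Gate),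
      (N (Nat.size (v 0))).num a < Nat.size (b v) :=
    fun v a => (hk _ a).trans_lt (hsize v)
  have hb2 : NatMem (CircFun N) (fun v : Fin 2 → ℕ => b fun _ => v 0) :=
    InAlgebra.comp (g := fun _ v => v 0) hb fun _ => NatMem.proj 0
  have hval := relMem_levelVal hb2 (fun v a => hnum (fun _ => v 0) a) d le_rfl
  have hsum : NatMem (CircFun N) (fun v : Fin 1 → ℕ =>
      ∑ j ∈ Finset.range (Nat.size (b v)), 2 ^ j * truth (LevelVal N d (v 0) j)) :=
    NatMem.sum_two_pow (R := fun j v => LevelVal N d (v 0) j)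
      (hval.comp₂ (f := fun w => w 1) (g := fun w => w 0) (.proj 1) (.proj 0)) hb
  have e : (fun v : Fin 1 → ℕ => (f (v 0) : ℤ)) = fun v => ((∑ j ∈ Finset.range (Nat.size (b v)),
      2 ^ j * truth (LevelVal N d (v 0) j) : ℕ) : ℤ) := by
    funext v
    rw [hf (v 0), outputNumber_eq_sum]
    -- the last output has number `numOut - 1`
    by_contra hlt
    have hpos : (C (Nat.size (v 0))).numOut - 1 < (C (Nat.size (v 0))).numOut := by omega
    have h := hnum v ((C _).out ⟨_, hpos⟩)
    rw [(N _).num_out] at h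
    simp only at h
    omega
  rw [e]
  exact hsum

end Evaluation

/-! ### Layering a circuit of constant depth -/

namespace Circuit

section Height

variable {n : ℕ} (c : Circuit n)

/-- All directed paths that end in the gate have at most `h` edges. -/
def HeightLE : ℕ → c.Gate → Prop
  | 0, b => ∀ a, ¬c.edge a b
  | h + 1, b => ∀ a, c.edge a b → HeightLE h a

theorem heightLE_of_depthLE {d : ℕ} (hd : c.DepthLE d) (b : c.Gate) : c.HeightLE d b := by
  have key : ∀ (h : ℕ) (b : c.Gate) (l : List c.Gate), (b :: l).IsChain c.edge →
      l.length + h = d → c.HeightLE h b := by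
    intro h
    induction h with
    | zero =>
      intro b l hl hlen a hab
      have := hd (a :: b :: l) (List.isChain_cons_cons.2 ⟨hab, hl⟩)
      simp only [List.length_cons] at this
      omega
    | succ h ih =>
      intro b l hl hlen a hab
      exact ih a (b :: l) (List.isChain_cons_cons.2 ⟨hab, hl⟩)
        (by simp only [List.length_cons]; omega)
  exact key d b [] (List.isChain_singleton b) (by simp)

end Height

section Layered

variable {n : ℕ} (c : Circuit n) (E : ℕ)

/-- The gates of the layered circuit: a literal, namely an input (`true`) or a negated input
(`false`); for each `l < E` and each gate `g` of `c` the copy `(l, some g)` of `g` on level `l + 1`,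
and the gate `(l, none)` on the same level, which has no predecessors; the outputs. -/
abbrev LayeredGate : Type :=
  (Bool × Fin n) ⊕ (Fin E × Option c.Gate) ⊕ Fin c.numOut

/-- The residue modulo `3` of the levels on which copies of a gate are computed from the copies of
its predecessors. A negation is computed as a parity. For literals there is no such residue, which
is encoded by the value `3`. -/
def evalResidue {n : ℕ} : GateKind n → ℕ
  | .or => 1
  | .and => 2
  | .mod2 => 0
  | .not => 0
  | .input _ => 3
  | .negInput _ => 3

/-- The predecessors, on the previous level, of the copy of `g` on level `L`. On a level where `g`
is computed, these are the copies of the predecessors of `g` and, if `g` is a negation, moreover the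
gate `none`, which adds the constant `1`. On the other levels it is the copy of `g`. -/
def Feeds (L : ℕ) (g : c.Gate) : Option c.Gate → Prop
  | some a => if L % 3 = evalResidue (c.kind g) then c.edge a g else a = g
  | none => L % 3 = evalResidue (c.kind g) ∧ c.kind g = GateKind.not

/-- The edges of the layered circuit. -/
def LayeredEdge : c.LayeredGate E → c.LayeredGate E → Prop
  | .inl (s, i), .inr (.inl (l, some g)) =>
    (l : ℕ) = 0 ∧ c.kind g = if s then GateKind.input i else GateKind.negInput i
  | .inr (.inl (l, a)), .inr (.inl (l', some g)) => (l' : ℕ) = l + 1 ∧ c.Feeds (l' + 1) g a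
  | .inr (.inl (l, a)), .inr (.inr j) => (l : ℕ) + 1 = E ∧ a = some (c.out j)
  | _, _ => False

/-- The level of a gate of the layered circuit. -/
def layeredLevel : c.LayeredGate E → ℕ
  | .inl _ => 0
  | .inr (.inl (l, _)) => l + 1
  | .inr (.inr _) => E + 1

theorem layeredLevel_of_edge {a b : c.LayeredGate E} (h : c.LayeredEdge E a b) :
    c.layeredLevel E b = c.layeredLevel E a + 1 := by
  rcases a with ⟨s, i⟩ | ⟨l, a⟩ | j <;> rcases b with ⟨s', i'⟩ | ⟨l', _ | g⟩ | j' <;>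
    simp only [LayeredEdge] at h <;> simp only [layeredLevel] <;> omega

/-- The label of the gates on a positive level of a normal form. -/
def levelKind (n L : ℕ) : GateKind n :=
  if L % 3 = 1 then .or else if L % 3 = 2 then .and else .mod2

/-- The label of a gate of the layered circuit. -/
def layeredKind : c.LayeredGate E → GateKind n
  | .inl (s, i) => if s then .input i else .negInput i
  | .inr (.inl (l, _)) => levelKind n (l + 1)
  | .inr (.inr _) => levelKind n (E + 1)

theorem levelKind_cases (n L : ℕ) : (levelKind n L = .or ∧ L % 3 = 1) ∨
    (levelKind n L = .and ∧ L % 3 = 2) ∨ (levelKind n L = .mod2 ∧ L % 3 = 0) := by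
  unfold levelKind
  split_ifs with h1 h2
  · exact .inl ⟨rfl, h1⟩
  · exact .inr (.inl ⟨rfl, h2⟩)
  · exact .inr (.inr ⟨rfl, by omega⟩)

/-- A gate that is not a literal is on a positive level and has the label of that level. -/
theorem layeredKind_cases (b : c.LayeredGate E) :
    (∃ s i, b = .inl (s, i)) ∨
      0 < c.layeredLevel E b ∧ c.layeredKind E b = levelKind n (c.layeredLevel E b) := by
  rcases b with ⟨s, i⟩ | ⟨l, a⟩ | j
  · exact .inl ⟨s, i, rfl⟩
  · exact .inr ⟨Nat.succ_pos _, rfl⟩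
  · exact .inr ⟨Nat.succ_pos _, rfl⟩

/-- The layered circuit: it has literals on level `0`, a copy of every gate of `c` on each of the
levels `1, …, E`, and the outputs on level `E + 1`. -/
def layered : Circuit n where
  Gate := c.LayeredGate E
  fintypeGate := inferInstance
  kind := c.layeredKind E
  edge := c.LayeredEdge E
  acyclic := Subrelation.wf (fun h => by
    simp only [InvImage, c.layeredLevel_of_edge E h]
    exact Nat.lt_succ_self _) (InvImage.wf (c.layeredLevel E) Nat.lt_wfRel.wf)
  no_edge_input a b h i hi := by
    have := c.layeredLevel_of_edge E h
    obtain ⟨s, j, rfl⟩ | ⟨-, hk⟩ := c.layeredKind_cases E b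
    · simp [layeredLevel] at this
    · obtain h | h | h := levelKind_cases n (c.layeredLevel E b) <;> simp [hk, h.1] at hi
  no_edge_negInput a b h i hi := by
    have := c.layeredLevel_of_edge E h
    obtain ⟨s, j, rfl⟩ | ⟨-, hk⟩ := c.layeredKind_cases E b
    · simp [layeredLevel] at this
    · obtain h | h | h := levelKind_cases n (c.layeredLevel E b) <;> simp [hk, h.1] at hi
  fanin_not b hb := by
    obtain ⟨s, j, rfl⟩ | ⟨-, hk⟩ := c.layeredKind_cases E b
    · cases s <;> simp [layeredKind] at hb
    · obtain h | h | h := levelKind_cases n (c.layeredLevel E b) <;> simp [hk, h.1] at hb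
  numOut := c.numOut
  out := ⟨fun j => .inr (.inr j), fun i j h => by simpa using h⟩

/-- The numbers of the gates of the layered circuit: those prescribed by the normal form on the
first and the last level, and pairwise distinct larger numbers in between. -/
noncomputable def layeredNum : c.LayeredGate E → ℕ
  | .inl (s, i) => if s then i else n + i
  | .inr (.inl q) => 2 * n + c.numOut + Fintype.equivFin (Fin E × Option c.Gate) q
  | .inr (.inr j) => j

theorem eq_of_layeredNum_eq {a : c.LayeredGate E} {q : Fin E × Option c.Gate}
    (h : c.layeredNum E a = c.layeredNum E (.inr (.inl q))) : a = .inr (.inl q) := by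
  rcases a with ⟨s, i⟩ | q' | j
  · have := i.2
    cases s <;> simp [layeredNum] at h <;> omega
  · simp only [layeredNum, Nat.add_left_cancel_iff, Fin.val_inj, EmbeddingLike.apply_eq_iff_eq] at h
    rw [h]
  · have := j.2
    simp only [layeredNum] at h
    omega

theorem layeredNum_inj {a b : c.LayeredGate E} (hl : c.layeredLevel E a = c.layeredLevel E b)
    (h : c.layeredNum E a = c.layeredNum E b) : a = b := by
  rcases b with ⟨s', i'⟩ | q | j'
  · rcases a with ⟨s, i⟩ | ⟨l, a⟩ | j
    · have := i.2
      have := i'.2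
      cases s <;> cases s' <;> simp [layeredNum] at h
      · rw [Fin.ext h]
      · omega
      · omega
      · rw [Fin.ext h]
    · simp [layeredLevel] at hl
    · simp [layeredLevel] at hl
  · exact c.eq_of_layeredNum_eq E h
  · rcases a with ⟨s, i⟩ | ⟨l, a⟩ | j
    · simp [layeredLevel] at hl
    · have := l.2
      simp only [layeredLevel] at hl
      omega
    · rw [Fin.ext (show (j : ℕ) = j' from h)]

/-- The layered circuit is in normal form. Every edge has an endpoint strictly between the first and
the last level, so the number of that endpoint identifies it. -/
noncomputable def layeredNormalForm (hE : E % 3 = 0) : NormalForm (c.layered E) (E + 1) where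
  level := c.layeredLevel E
  num := c.layeredNum E
  level_le := by
    rintro (⟨s, i⟩ | ⟨l, a⟩ | j)
    · exact Nat.zero_le _
    · have := l.2
      simp only [layeredLevel]
      omega
    · exact le_rfl
  level_input b i hi := by
    obtain ⟨s, j, rfl⟩ | ⟨-, hk⟩ := c.layeredKind_cases E b
    · rfl
    · change c.layeredKind E b = _ at hi
      obtain h | h | h := levelKind_cases n (c.layeredLevel E b) <;> simp [hk, h.1] at hi
  level_negInput b i hi := by
    obtain ⟨s, j, rfl⟩ | ⟨-, hk⟩ := c.layeredKind_cases E b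
    · rfl
    · change c.layeredKind E b = _ at hi
      obtain h | h | h := levelKind_cases n (c.layeredLevel E b) <;> simp [hk, h.1] at hi
  no_not b hb := by
    change c.layeredKind E b = _ at hb
    obtain ⟨s, j, rfl⟩ | ⟨-, hk⟩ := c.layeredKind_cases E b
    · cases s <;> simp [layeredKind] at hb
    · obtain h | h | h := levelKind_cases n (c.layeredLevel E b) <;> simp [hk, h.1] at hb
  level_or b hb := by
    change c.layeredKind E b = _ at hb
    obtain ⟨s, j, rfl⟩ | ⟨-, hk⟩ := c.layeredKind_cases E b
    · cases s <;> simp [layeredKind] at hb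
    · obtain h | h | h := levelKind_cases n (c.layeredLevel E b) <;> simp [hk, h.1] at hb
      exact h.2
  level_and b hb := by
    change c.layeredKind E b = _ at hb
    obtain ⟨s, j, rfl⟩ | ⟨-, hk⟩ := c.layeredKind_cases E b
    · cases s <;> simp [layeredKind] at hb
    · obtain h | h | h := levelKind_cases n (c.layeredLevel E b) <;> simp [hk, h.1] at hb
      exact h.2
  level_mod2 b hb := by
    change c.layeredKind E b = _ at hb
    obtain ⟨s, j, rfl⟩ | ⟨hpos, hk⟩ := c.layeredKind_cases E b
    · cases s <;> simp [layeredKind] at hb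
    · obtain h | h | h := levelKind_cases n (c.layeredLevel E b) <;> simp [hk, h.1] at hb
      exact ⟨h.2, hpos⟩
  level_edge a b h := c.layeredLevel_of_edge E h
  num_inj a b hl h := c.layeredNum_inj E hl h
  num_input b i hi := by
    change c.layeredKind E b = _ at hi
    obtain ⟨s, j, rfl⟩ | ⟨-, hk⟩ := c.layeredKind_cases E b
    · cases s <;> simp [layeredKind] at hi
      rw [← hi]
      rfl
    · obtain h | h | h := levelKind_cases n (c.layeredLevel E b) <;> simp [hk, h.1] at hi
  num_negInput b i hi := by
    change c.layeredKind E b = _ at hi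
    obtain ⟨s, j, rfl⟩ | ⟨-, hk⟩ := c.layeredKind_cases E b
    · cases s <;> simp [layeredKind] at hi
      rw [← hi]
      rfl
    · obtain h | h | h := levelKind_cases n (c.layeredLevel E b) <;> simp [hk, h.1] at hi
  level_eq_iff := by
    rintro (⟨s, i⟩ | ⟨l, a⟩ | j)
    · refine iff_of_false (Nat.succ_ne_zero E).symm ?_
      rintro ⟨j, hj⟩
      cases hj
    · refine iff_of_false (fun h => l.2.ne (Nat.succ_injective h)) ?_
      rintro ⟨j, hj⟩
      cases hj
    · exact iff_of_true rfl ⟨j, rfl⟩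
  num_out j := rfl
  edge_of_num a b a' b' h ha hb hl := by
    have hl' := c.layeredLevel_of_edge E h
    rcases b' with ⟨s', i'⟩ | q | j'
    · simp [layeredLevel] at hl'
    · obtain rfl := c.eq_of_layeredNum_eq E hb.symm
      obtain rfl := c.layeredNum_inj E (by omega) ha
      exact h
    · rcases a' with ⟨s, i⟩ | q | j
      · exact h.elim
      · obtain rfl := c.eq_of_layeredNum_eq E ha.symm
        obtain rfl := c.layeredNum_inj E (by omega) hb
        exact h
      · exact h.elim

/-! ### Values and size of the layered circuit -/

variable {c E} (x : Fin n → Bool)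

theorem val_layered_lit (s : Bool) (i : Fin n) :
    (c.layered E).val x (.inl (s, i)) = if s then x i else !(x i) := by
  cases s
  · exact (c.layered E).val_of_negInput x rfl
  · exact (c.layered E).val_of_input x rfl

theorem layered_transmits {a b : c.LayeredGate E} (hb : 0 < c.layeredLevel E b)
    (h : ∀ a', c.LayeredEdge E a' b ↔ a' = a) :
    (c.layered E).val x b = (c.layered E).val x a := by
  refine (c.layered E).val_eq_of_edge_iff_eq x ?_ h
  obtain ⟨s, j, rfl⟩ | ⟨-, hk⟩ := c.layeredKind_cases E b
  · simp [layeredLevel] at hb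
  · exact (levelKind_cases n (c.layeredLevel E b)).imp (fun h => hk.trans h.1)
      (Or.imp (fun h => hk.trans h.1) fun h => hk.trans h.1)

/-- The predecessors of a copy on a level other than the first one are on the previous level. -/
theorem layeredEdge_succ_iff {l l' : Fin E} (hl : (l' : ℕ) = l + 1) {g : c.Gate}
    {a' : c.LayeredGate E} : c.LayeredEdge E a' (.inr (.inl (l', some g))) ↔
      ∃ a, a' = .inr (.inl (l, a)) ∧ c.Feeds (l' + 1) g a := by
  rcases a' with ⟨s, i⟩ | ⟨k, a⟩ | j
  · simp only [LayeredEdge, reduceCtorEq, false_and, exists_false, iff_false]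
    omega
  · simp only [LayeredEdge, Sum.inr.injEq, Sum.inl.injEq, Prod.mk.injEq]
    constructor
    · rintro ⟨h1, h2⟩
      exact ⟨a, ⟨Fin.ext (by omega), rfl⟩, h2⟩
    · rintro ⟨a, ⟨rfl, rfl⟩, h2⟩
      exact ⟨hl, h2⟩
  · simp [LayeredEdge]

/-- On a level where `g` is not computed, the copy of `g` has the value of the previous copy. -/
theorem val_layered_transmit {l l' : Fin E} (hl : (l' : ℕ) = l + 1) {g : c.Gate}
    (hr : (l' + 1 : ℕ) % 3 ≠ evalResidue (c.kind g)) :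
    (c.layered E).val x (.inr (.inl (l', some g))) =
      (c.layered E).val x (.inr (.inl (l, some g))) := by
  refine layered_transmits x (Nat.succ_pos _) fun a' => ?_
  rw [layeredEdge_succ_iff hl]
  constructor
  · rintro ⟨_ | a, rfl, h⟩
    · exact absurd h.1 hr
    · simp only [Feeds, if_neg hr] at h
      rw [h]
  · rintro rfl
    exact ⟨some g, rfl, by simp [Feeds, hr]⟩

theorem val_layered_none {l : Fin E} (hl : (l + 1 : ℕ) % 3 = 2) :
    (c.layered E).val x (.inr (.inl (l, none))) = true := by
  have hk : (c.layered E).kind (.inr (.inl (l, none))) = GateKind.and := by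
    change levelKind n (l + 1) = _
    simp [levelKind, hl]
  rw [val_of_and _ x hk]
  rintro (⟨s, i⟩ | ⟨k, a⟩ | j) h <;> exact h.elim

/-- On a level where `g` is computed, the copy of `g` has the value of `g` as soon as this holds for
the copies of the predecessors of `g` on the previous level. -/
theorem val_layered_compute {l l' : Fin E} (hl : (l' : ℕ) = l + 1) {g : c.Gate}
    (hr : (l' + 1 : ℕ) % 3 = evalResidue (c.kind g))
    (hp : ∀ a, c.edge a g → (c.layered E).val x (.inr (.inl (l, some a))) = c.val x a) :
    (c.layered E).val x (.inr (.inl (l', some g))) = c.val x g := by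
  have hcopies : c.kind g = GateKind.or ∨ c.kind g = GateKind.and ∨ c.kind g = GateKind.mod2 →
      levelKind n (l' + 1) = c.kind g →
      (c.layered E).val x (.inr (.inl (l', some g))) = c.val x g := by
    intro hg hk
    refine c.val_eq_of_copies x (c' := c.layered E) (φ := fun a => .inr (.inl (l, some a)))
      (fun a a' h => Option.some.inj (Prod.mk.inj (Sum.inl.inj (Sum.inr.inj h))).2) hg hk
      (fun a' => ?_) hp
    refine (layeredEdge_succ_iff hl).trans ⟨?_, ?_⟩
    · rintro ⟨_ | a, rfl, h⟩
      · have hnot := h.2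
        simp [hnot] at hg
      · simp only [Feeds, if_pos hr] at h
        exact ⟨a, h, rfl⟩
    · rintro ⟨a, h, rfl⟩
      exact ⟨some a, rfl, by simp [Feeds, hr, h]⟩
  rcases hk : c.kind g with i | i | _ | _ | _ | _
  · rw [hk, evalResidue] at hr
    omega
  · rw [hk, evalResidue] at hr
    omega
  · -- the predecessors are the copy of the single predecessor `a` of `g` and a constant `1`
    simp only [hk, evalResidue] at hr
    obtain ⟨a, ha, huniq⟩ := c.fanin_not g hk
    have hone := val_layered_none (c := c) x (l := l) (by omega)
    have hv := (c.layered E).val_eq_not_of_mod2 x (b := .inr (.inl (l', some g)))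
      (a := .inr (.inl (l, some a))) (one := .inr (.inl (l, none))) ?_
      (fun h => by cases h) hone fun a' => ?_
    · have hnot : c.val x g = true ↔ c.val x a = false :=
        (c.val_of_not x hk).trans ⟨fun h => h a ha, fun h a' ha' => by rwa [huniq a' ha']⟩
      rw [hv, hp a ha, Bool.eq_iff_iff, hnot, Bool.not_eq_true']
    · change levelKind n (l' + 1) = _
      rw [levelKind, if_neg (by omega), if_neg (by omega)]
    · refine (layeredEdge_succ_iff hl).trans ⟨?_, ?_⟩
      · rintro ⟨_ | a₁, rfl, h⟩
        · exact .inr rfl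
        · simp only [Feeds, hk, evalResidue, if_pos hr] at h
          exact .inl (by rw [huniq a₁ h])
      · rintro (rfl | rfl)
        · exact ⟨some a, rfl, by simp [Feeds, hk, evalResidue, hr, ha]⟩
        · exact ⟨none, rfl, by simp [Feeds, hk, evalResidue, hr]⟩
  all_goals
    refine hcopies (by simp [hk]) ?_
    simp only [hk, evalResidue] at hr
    simp [hk, levelKind, hr]

theorem val_layered_of_isLit {g : c.Gate} {s : Bool} {i : Fin n}
    (hg : c.kind g = if s then GateKind.input i else GateKind.negInput i) (l : ℕ) (hl : l < E) :
    (c.layered E).val x (.inr (.inl (⟨l, hl⟩, some g))) = c.val x g := by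
  induction l with
  | zero =>
    have hv : c.val x g = if s then x i else !(x i) := by
      cases s
      · exact c.val_of_negInput x (by simpa using hg)
      · exact c.val_of_input x (by simpa using hg)
    rw [hv, ← val_layered_lit (c := c) (E := E)]
    refine layered_transmits x (Nat.succ_pos _) fun a' => ?_
    rcases a' with ⟨s', i'⟩ | ⟨k, a⟩ | j
    · simp only [LayeredEdge, true_and, Sum.inl.injEq, Prod.mk.injEq, hg]
      cases s <;> cases s' <;> simp [eq_comm]
    · simp [LayeredEdge]
    · simp [LayeredEdge]
  | succ l ih =>
    rw [← ih (by omega)]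
    refine val_layered_transmit x (l := ⟨l, by omega⟩) (l' := ⟨l + 1, hl⟩) rfl ?_
    have : (l + 1 + 1) % 3 < 3 := Nat.mod_lt _ (by norm_num)
    cases s <;> simp [hg, evalResidue] <;> omega

/-- Three levels suffice for each unit of height, since among any three consecutive levels there is
one where the gate is computed. Afterwards its copies are either copied or computed again. -/
theorem val_layered_of_heightLE {h : ℕ} {g : c.Gate} (hg : c.HeightLE h g) (l : ℕ) (hl : l < E)
    (hh : 3 * h + 3 ≤ l) : (c.layered E).val x (.inr (.inl (⟨l, hl⟩, some g))) = c.val x g := by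
  induction h using Nat.strong_induction_on generalizing g l with
  | _ h ih =>
    by_cases hlit : ∃ (s : Bool) (i : Fin n),
        c.kind g = if s then GateKind.input i else GateKind.negInput i
    · obtain ⟨s, i, hs⟩ := hlit
      exact val_layered_of_isLit x hs l hl
    have hres : evalResidue (c.kind g) < 3 := by
      rcases hk : c.kind g with i | i | _ | _ | _ | _
      · exact absurd ⟨true, i, by simp [hk]⟩ hlit
      · exact absurd ⟨false, i, by simp [hk]⟩ hlit
      all_goals simp [evalResidue]
    have hpred : ∀ (k : ℕ) (hk : k < E), 3 * h ≤ k → ∀ a, c.edge a g →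
        (c.layered E).val x (.inr (.inl (⟨k, hk⟩, some a))) = c.val x a := by
      intro k hk hhk a ha
      cases h with
      | zero => exact absurd ha (hg a)
      | succ h => exact ih h (Nat.lt_succ_self h) (hg a ha) k hk (by omega)
    -- the copies of the predecessors of `g` at position `r`, on level `r + 1`, have the right values,
    -- and `g` is computed on the next level
    have key : ∀ (r m : ℕ), 3 * h ≤ r → (r + 1 + 1) % 3 = evalResidue (c.kind g) →
        ∀ hm : r + 1 + m < E,
          (c.layered E).val x (.inr (.inl (⟨r + 1 + m, hm⟩, some g))) = c.val x g := by
      intro r m hr hmod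
      induction m with
      | zero =>
        intro hm
        exact val_layered_compute x (l := ⟨r, by omega⟩) (l' := ⟨r + 1, hm⟩) rfl hmod
          (hpred r _ hr)
      | succ m ihm =>
        intro hm
        by_cases hmod' : (r + 1 + (m + 1) + 1) % 3 = evalResidue (c.kind g)
        · exact val_layered_compute x (l := ⟨r + 1 + m, by omega⟩) (l' := ⟨r + 1 + (m + 1), hm⟩)
            rfl hmod' (hpred _ _ (by omega))
        · rw [← ihm (by omega)]
          exact val_layered_transmit x (l := ⟨r + 1 + m, by omega⟩)
            (l' := ⟨r + 1 + (m + 1), hm⟩) rfl hmod'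
    obtain ⟨r, hr, hr', hmod⟩ : ∃ r, 3 * h ≤ r ∧ r + 1 ≤ 3 * h + 3 ∧
        (r + 1 + 1) % 3 = evalResidue (c.kind g) := by
      obtain h0 | h0 | h0 : evalResidue (c.kind g) = 0 ∨ evalResidue (c.kind g) = 1 ∨
        evalResidue (c.kind g) = 2 := by omega
      · exact ⟨3 * h + 1, by omega, by omega, by omega⟩
      · exact ⟨3 * h + 2, by omega, by omega, by omega⟩
      · exact ⟨3 * h, by omega, by omega, by omega⟩
    have := key r (l - (r + 1)) hr hmod (by omega)
    have e : r + 1 + (l - (r + 1)) = l := by omega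
    simpa only [e] using this

theorem outputNumber_layered {D : ℕ} (hD : c.DepthLE D) (hE : 3 * D + 3 < E) :
    (c.layered E).outputNumber x = c.outputNumber x := by
  refine Finset.sum_congr rfl fun j _ => ?_
  have h : (c.layered E).val x ((c.layered E).out j) =
      (c.layered E).val x (.inr (.inl (⟨E - 1, by omega⟩, some (c.out j)))) := by
    refine layered_transmits x (Nat.succ_pos _) fun a' => ?_
    rcases a' with ⟨s, i⟩ | ⟨k, a⟩ | j'
    · change False ↔ _
      simp
    · change (k : ℕ) + 1 = E ∧ a = some (c.out j) ↔ _
      simp only [Sum.inr.injEq, Sum.inl.injEq, Prod.mk.injEq, Fin.ext_iff]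
      have := k.2
      exact and_congr_left fun _ => by omega
    · change False ↔ _
      simp
  rw [h, val_layered_of_heightLE x (c.heightLE_of_depthLE hD _) _ _ (by omega)]

theorem size_layered : (c.layered E).size = 2 * n + E * (c.size + 1) + c.numOut := by
  change Fintype.card (c.LayeredGate E) = _
  simp [LayeredGate, Circuit.size, add_assoc]

theorem layeredNum_le (a : c.LayeredGate E) :
    c.layeredNum E a ≤ 2 * n + E * (c.size + 1) + c.numOut := by
  rcases a with ⟨s, i⟩ | q | j
  · have := i.2
    cases s <;> simp [layeredNum] <;> omega
  · have h := (Fintype.equivFin (Fin E × Option c.Gate) q).2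
    simp only [Fintype.card_prod, Fintype.card_fin, Fintype.card_option] at h
    simp only [layeredNum, Circuit.size]
    omega
  · have := j.2
    simp only [layeredNum]
    omega

theorem numOut_le_size : c.numOut ≤ c.size := by
  simpa [Circuit.size] using Fintype.card_le_of_injective c.out c.out.injective

end Layered

end Circuit

/-! ### Polynomial bounds and the normal form of a family -/

theorem mul_pow_add_le_pow_add (A B k n : ℕ) :
    A * n ^ k + B ≤ n ^ (A + B + k) + (A + B + k) := by
  rcases n with _ | _ | n
  · rcases k with _ | k
    · simp
    · simp
      omega
  · simp
    omega
  · have h1 : A ≤ (n + 2) ^ (A + B) :=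
      ((Nat.lt_pow_self (by omega)).le).trans
        (Nat.pow_le_pow_right (by omega) (Nat.le_add_right _ _))
    have h2 := Nat.mul_le_mul_right ((n + 2) ^ k) h1
    rw [← pow_add] at h2
    change A * (n + 2) ^ k + B ≤ (n + 2) ^ (A + B + k) + _
    omega

theorem exists_normalForm_of_constDepth {f : ℕ → ℕ} {C : (n : ℕ) → Circuit n} (hs : PolySize C)
    (hd : ConstDepth C) (hf : Computes C f) :
    ∃ (C' : (n : ℕ) → Circuit n) (d : ℕ) (N : (n : ℕ) → NormalForm (C' n) d),
      PolySize C' ∧ PolyNumbered N ∧ Computes C' f := by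
  obtain ⟨k, hk⟩ := hs
  obtain ⟨D, hD⟩ := hd
  -- a multiple of `3`, so that the outputs on level `E + 1` are `or` gates
  obtain ⟨E, hE, hE3⟩ : ∃ E, 3 * D + 3 < E ∧ E % 3 = 0 := ⟨3 * (D + 2), by omega, by omega⟩
  obtain ⟨K, hK⟩ : ∃ K : ℕ, ∀ n,
      2 * n + E * ((C n).size + 1) + (C n).numOut ≤ n ^ K + K := by
    refine ⟨(3 + E) + (E * (k + 2) + k + 1) + (k + 1), fun n => ?_⟩
    refine le_trans ?_ (mul_pow_add_le_pow_add (3 + E) (E * (k + 2) + k + 1) (k + 1) n)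
    have h1 := hk n
    have h2 := (C n).numOut_le_size
    have h3 : n ≤ n ^ (k + 1) := Nat.le_self_pow (Nat.succ_ne_zero k) n
    have h4 : n ^ k ≤ n ^ (k + 1) + 1 := by
      obtain rfl | hn := Nat.eq_zero_or_pos n
      · obtain rfl | hk0 := Nat.eq_zero_or_pos k
        · simp
        · simp [hk0.ne']
      · exact (Nat.pow_le_pow_right hn (Nat.le_succ k)).trans (Nat.le_succ _)
    have h5 : E * ((C n).size + 1) ≤ E * (n ^ (k + 1) + (k + 2)) :=
      Nat.mul_le_mul_left E (by omega)
    rw [mul_add E (n ^ (k + 1))] at h5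
    rw [add_mul]
    omega
  refine ⟨fun n => (C n).layered E, E + 1, fun n => (C n).layeredNormalForm E hE3,
    ⟨K, fun n => ?_⟩, ⟨K, fun n g => ?_⟩, fun x => ?_⟩
  · rw [Circuit.size_layered]
    exact hK n
  · exact ((C n).layeredNum_le g).trans (hK n)
  · rw [hf x, Circuit.outputNumber_layered _ (hD _) hE]

/-- (1) If `f` is computed by a polynomial-size, constant-depth family in normal form, with parity
gates, then `f` is in the algebra over the functions describing that family. (2) Every `f` computed
by any polynomial-size, constant-depth family with parity gates is computed by such a family in
normal form, so that (1) applies to it. -/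
theorem mainTheorem9 (f : ℕ → ℕ) :
    (∀ (C : (n : ℕ) → Circuit n) (d : ℕ) (N : (n : ℕ) → NormalForm (C n) d),
      PolySize C → PolyNumbered N → Computes C f →
        InAlgebra (CircFun N) 1 (fun v => (f (v 0) : ℤ))) ∧
    (∀ C : (n : ℕ) → Circuit n, PolySize C → ConstDepth C → Computes C f →
      ∃ (C' : (n : ℕ) → Circuit n) (d : ℕ) (N : (n : ℕ) → NormalForm (C' n) d),
        PolySize C' ∧ PolyNumbered N ∧ Computes C' f) :=
  ⟨fun _ _ _ _ hN hf => inAlgebra_of_computes hN hf,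
    fun _ hs hd hf => exists_normalForm_of_constDepth hs hd hf⟩
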